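/- Let $(A,B)$ be a random vector in $\mathbb R^2$ with $A>0$ a.s., let $(A_n,B_n)_{n\ge 1}$ be i.i.d. copies of $(A,B)$, let $X_0$ be a real random variable independent of $(A_n,B_n)_{n\ge1}$, and let $X_n=A_nX_{n-1}+B_n$ for $n\ge 1$. Suppose that for some $\alpha>0$: (i) $\mathbb E[A^\alpha]<\infty$ and, for every $y>0$, $\mathbb P[A>ty]\sim y^{-\alpha}\,\mathbb P[A>t]$ as $t\to\infty$; (ii) $\mathbb P[AA'>t]\sim 2\,\mathbb E[A^\alpha]\,\mathbb P[A>t]$ as $t\to\infty$, where $A'$ is an independent copy of $A$; (iii) $\mathbb E[A^\alpha]<1$; (iv) $\limsup_{t\to\infty}\mathbb P[|B|>t]/\mathbb P[A>t]<\infty$. Here $g(t)\sim h(t)$ means $g(t)/h(t)\to1$ as $t\to\infty$. Then the series $$X=\sum_{k=0}^\infty B_{k+1}\prod_{j=1}^kA_j$$ converges absolutely a.s.; its law is the unique probability law satisfying $X\stackrel{d}{=}AX+B$ with $X$ independent of $(A,B)$; the Markov chain $(X_n)_{n\ge0}$ converges weakly to $X$; and $$\mathbb P[|X|>t]=O(\mathbb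 P[A>t])\qquad\text{as }t\to\infty .$$ If, furthermore, $\mathbb P[A>t,\,B<-t]=o(\mathbb P[A>t])$ as $t\to\infty$ and there is no $c\in\mathbb R$ with $Ac+B=c$ a.s. (equivalently, $X$ is not a.s. constant), then $\mathbb P[|X|>t]\asymp\mathbb P[A>t]$, that is, $$0<\liminf_{t\to\infty}\frac{\mathbb P[|X|>t]}{\mathbb P[A>t]}\le\limsup_{t\to\infty}\frac{\mathbb P[|X|>t]}{\mathbb P[A>t]}<\infty .$$ -/

import Mathlib

open MeasureTheory ProbabilityTheory Filter Topology Asymptotics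
open scoped ENNReal

noncomputable section

/-- `g(t) ∼ h(t)` as `t → ∞`, i.e. `g(t) / h(t) → 1` (this forces `h(t) ≠ 0` for large `t`). -/
def AsympEq (g h : ℝ → ℝ) : Prop :=
  Tendsto (fun t => g t / h t) atTop (𝓝 1)

/-- `g(t) ≍ h(t)` as `t → ∞`, i.e. `0 < liminf g(t) / h(t) ≤ limsup g(t) / h(t) < ∞`,
with the limits inferior and superior computed in `[0, ∞]`. -/
def WeaklyEquiv (g h : ℝ → ℝ≥0∞) : Prop :=
  0 < liminf (fun t => g t / h t) atTop ∧ limsup (fun t => g t / h t) atTop < ∞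

variable {Ω : Type*}

/-- The affine recursion `X_{n+1} = A_{n+1} X_n + B_{n+1}` started at `X₀`.
The coefficient pairs are indexed from `0`, so `(A n, B n)` stands for `(A_{n+1}, B_{n+1})`. -/
def affineChain (A B : ℕ → Ω → ℝ) (X₀ : Ω → ℝ) : ℕ → Ω → ℝ
  | 0 => X₀
  | n + 1 => fun ω => A n ω * affineChain A B X₀ n ω + B n ω

/-- The terms `B_{k+1} A_1 ⋯ A_k` of the perpetuity series. -/
def perpetuityTerm (A B : ℕ → Ω → ℝ) (k : ℕ) (ω : Ω) : ℝ :=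
  B k ω * ∏ j ∈ Finset.range k, A j ω

/-- The perpetuity `X = ∑_{k ≥ 0} B_{k+1} A_1 ⋯ A_k`. -/
def perpetuity (A B : ℕ → Ω → ℝ) (ω : Ω) : ℝ :=
  ∑' k, perpetuityTerm A B k ω

/-- `ν` is the law of a random variable `X` with `X = A X + B` in distribution, where `X` is
independent of `(A, B)` and `(A, B)` has law `κ`. -/
def IsStationaryLaw (κ : Measure (ℝ × ℝ)) (ν : Measure ℝ) : Prop :=
  (κ.prod ν).map (fun p : (ℝ × ℝ) × ℝ => p.1.1 * p.2 + p.1.2) = ν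

end

/-!
The law of the Markov chain evolves by iterating the map that sends `ν` to the law of `A x + B`,
where `x ∼ ν` is independent of `(A, B)`. The backward iterates of the random affine maps have the
same laws, but they converge almost surely to `X`: with `δ = min α 1` the moments
`E[(A_1 ⋯ A_k)^δ |B_{k+1}|^δ]` form a geometric series. Hence the iterates started from any law
converge to the law of `X`, which gives its stationarity and uniqueness and the convergence of the
chain at once.

For the upper bound let `Y` have the law of `A` conditioned on `A > t₀`. By Breiman's lemma the part
of `{A A' > t}` with `A' ≤ K` has probability `∼ E[A^α; A ≤ K] P(A > t)`, so (ii) leaves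
`2 E[A^α] - E[A^α; A ≤ K]` for the part with `A' > K`, which is less than `1` for large `K`. For
large `t₀` it follows that `P(A Y > (1 - d) t) + P(|B| > d t) ≤ P(Y > t)` for all `t ≥ t₀`, so
domination of `|X_n|` by `Y` in distribution passes to `|X_{n+1}|`; start the chain at `0`.

For the lower bound, if `P(X > δ) > 0`, a large `A` makes `A X + B` large unless `B` is very
negative. If `X ≤ 0` almost surely, choose `c₁ < c₂` with `P(X < c₁) > 0` and `P(X > c₂) > 0`. The
latter forces `A c₂ + B ≤ 0`, so that `A X + B ≤ -A (c₂ - c₁)` when `X < c₁`.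
-/

theorem indepFun_prodMk_of_indepFun_prodMk_right {Ω E F G : Type*} [MeasurableSpace Ω]
    [MeasurableSpace E] [MeasurableSpace F] [MeasurableSpace G] {μ : Measure Ω}
    [IsFiniteMeasure μ] {X : Ω → E} {Y : Ω → F} {Z : Ω → G} (hX : AEMeasurable X μ)
    (hY : AEMeasurable Y μ) (hZ : AEMeasurable Z μ)
    (hXYZ : IndepFun X (fun ω => (Y ω, Z ω)) μ) (hYZ : IndepFun Y Z μ) :
    IndepFun (fun ω => (X ω, Y ω)) Z μ := by
  have hXY : IndepFun X Y μ := hXYZ.comp measurable_id measurable_fst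
  refine (indepFun_iff_map_prod_eq_prod_map_map (hX.prodMk hY) hZ).2 ?_
  calc μ.map (fun ω => ((X ω, Y ω), Z ω))
      = (μ.map fun ω => (X ω, (Y ω, Z ω))).map MeasurableEquiv.prodAssoc.symm := by
        rw [AEMeasurable.map_map_of_aemeasurable (by fun_prop) (hX.prodMk (hY.prodMk hZ))]
        rfl
    _ = ((μ.map X).prod ((μ.map Y).prod (μ.map Z))).map MeasurableEquiv.prodAssoc.symm := by
        rw [hXYZ.map_prod_eq_prod_map_map hX (hY.prodMk hZ), hYZ.map_prod_eq_prod_map_map hY hZ]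
    _ = ((μ.map X).prod (μ.map Y)).prod (μ.map Z) := by
        rw [← Measure.prodAssoc_prod, MeasurableEquiv.map_symm_map]
    _ = _ := by rw [hXY.map_prod_eq_prod_map_map hX hY]

theorem exists_probabilityMeasure_hasLaw {Ω E : Type*} [MeasurableSpace Ω] [MeasurableSpace E]
    {P : Measure Ω} [IsProbabilityMeasure P] {X : Ω → E} (hX : AEMeasurable X P) :
    ∃ μ : ProbabilityMeasure E, HasLaw X μ P :=
  ⟨⟨P.map X, Measure.isProbabilityMeasure_map hX⟩, hX, rfl⟩

theorem measureReal_setOf_lt_abs_of_hasLaw {Ω : Type*} [MeasurableSpace Ω] {P : Measure Ω}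
    {X : Ω → ℝ} {ν : Measure ℝ} (hX : HasLaw X ν P) (t : ℝ) :
    P.real {ω | t < |X ω|} = ν.real {x | t < |x|} :=
  hX.measureReal_eq (p := fun x => t < |x|) (measurableSet_lt measurable_const measurable_abs)

theorem tendstoInDistribution_iff_of_hasLaw {Ω Ω' ι E : Type*} [MeasurableSpace Ω]
    [MeasurableSpace Ω'] [TopologicalSpace E] [MeasurableSpace E] [OpensMeasurableSpace E]
    {P : Measure Ω} [IsProbabilityMeasure P] {P' : Measure Ω'} [IsProbabilityMeasure P']
    {X : ι → Ω → E} {Z : Ω' → E} {μ : ι → ProbabilityMeasure E} {ν : ProbabilityMeasure E}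
    {l : Filter ι} (hX : ∀ i, HasLaw (X i) (μ i) P) (hZ : HasLaw Z ν P') :
    TendstoInDistribution X l Z (fun _ => P) P' ↔ Tendsto μ l (𝓝 ν) := by
  have hμ (i : ι) : μ i = ⟨P.map (X i), Measure.isProbabilityMeasure_map (hX i).aemeasurable⟩ :=
    Subtype.ext (hX i).map_eq.symm
  have hν : ν = ⟨P'.map Z, Measure.isProbabilityMeasure_map hZ.aemeasurable⟩ :=
    Subtype.ext hZ.map_eq.symm
  rw [hν, funext hμ]
  exact ⟨fun h => h.tendsto, fun h => ⟨fun i => (hX i).aemeasurable, hZ.aemeasurable, h⟩⟩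

/-- The law of `A x + B` when `(A, B)` has law `κ` and `x`, independent of `(A, B)`, has law `ν`.
The law of the Markov chain evolves by iteration of this map. -/
noncomputable def affineStep (κ : ProbabilityMeasure (ℝ × ℝ)) (ν : ProbabilityMeasure ℝ) :
    ProbabilityMeasure ℝ :=
  (κ.prod ν).map (f := fun p : (ℝ × ℝ) × ℝ => p.1.1 * p.2 + p.1.2) (by fun_prop)

theorem isStationaryLaw_iff_isFixedPt_affineStep {κ : ProbabilityMeasure (ℝ × ℝ)}
    {ν : ProbabilityMeasure ℝ} :
    IsStationaryLaw (κ : Measure (ℝ × ℝ)) (ν : Measure ℝ) ↔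
      Function.IsFixedPt (affineStep κ) ν :=
  (Subtype.ext_iff (a1 := affineStep κ ν) (a2 := ν)).symm

theorem continuous_affineStep (κ : ProbabilityMeasure (ℝ × ℝ)) : Continuous (affineStep κ) :=
  (ProbabilityMeasure.continuous_map (by fun_prop)).comp
    (ProbabilityMeasure.continuous_prod.comp (Continuous.prodMk_right κ))

theorem indepFun_prodMk_zero_shift {Ω E F : Type*} [MeasurableSpace Ω] [MeasurableSpace E]
    [MeasurableSpace F] {P : Measure Ω} {X : Ω → E} {U : ℕ → Ω → F}
    (h : IndepFun X (fun ω n => U n ω) P) :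
    IndepFun X (fun ω => (U 0 ω, fun n => U (n + 1) ω)) P :=
  h.comp (ψ := fun s : ℕ → F => (s 0, fun n => s (n + 1))) measurable_id (by fun_prop)

/-- The pairs `(A n, B n)` are independent with common law `κ`. -/
structure IsIIDPairs {Ω : Type*} [MeasurableSpace Ω] (A B : ℕ → Ω → ℝ)
    (κ : ProbabilityMeasure (ℝ × ℝ)) (P : Measure Ω) : Prop where
  measurable_pair : ∀ n, Measurable (fun ω => (A n ω, B n ω))
  iIndepFun : iIndepFun (fun n ω => (A n ω, B n ω)) P
  hasLaw : ∀ n, HasLaw (fun ω => (A n ω, B n ω)) κ P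

/-- The backward iterates `φ₀ ∘ ⋯ ∘ φₙ₋₁ (X₀)` of the random affine maps `φₖ x = A k * x + B k`;
`affineChain` consists of the forward iterates `φₙ₋₁ ∘ ⋯ ∘ φ₀ (X₀)`. -/
noncomputable def backwardChain {Ω : Type*} (A B : ℕ → Ω → ℝ) (X₀ : Ω → ℝ) : ℕ → Ω → ℝ
  | 0 => X₀
  | n + 1 => fun ω =>
    A 0 ω * backwardChain (fun k => A (k + 1)) (fun k => B (k + 1)) X₀ n ω + B 0 ω

theorem backwardChain_comp {Ω Ω' : Type*} (A B : ℕ → Ω → ℝ) (X₀ : Ω → ℝ) (φ : Ω' → Ω) (n : ℕ) :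
    backwardChain (fun k => A k ∘ φ) (fun k => B k ∘ φ) (X₀ ∘ φ) n =
      backwardChain A B X₀ n ∘ φ := by
  induction n generalizing A B with
  | zero => rfl
  | succ n ih =>
    funext ω
    simp only [backwardChain, Function.comp_apply,
      congrFun (ih (fun k => A (k + 1)) fun k => B (k + 1)) ω]

theorem measurable_backwardChain {Ω : Type*} [MeasurableSpace Ω] {A B : ℕ → Ω → ℝ} {X₀ : Ω → ℝ}
    (hA : ∀ n, Measurable (A n)) (hB : ∀ n, Measurable (B n)) (hX₀ : Measurable X₀) (n : ℕ) :
    Measurable (backwardChain A B X₀ n) := by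
  induction n generalizing A B with
  | zero => exact hX₀
  | succ n ih => exact ((hA 0).mul (ih (fun k => hA (k + 1)) fun k => hB (k + 1))).add (hB 0)

theorem backwardChain_eq_sum_perpetuityTerm_add {Ω : Type*} (A B : ℕ → Ω → ℝ) (X₀ : Ω → ℝ)
    (n : ℕ) (ω : Ω) :
    backwardChain A B X₀ n ω =
      ∑ k ∈ Finset.range n, perpetuityTerm A B k ω + (∏ j ∈ Finset.range n, A j ω) * X₀ ω := by
  induction n generalizing A B with
  | zero => simp [backwardChain]
  | succ n ih =>
    have hshift (k : ℕ) : perpetuityTerm A B (k + 1) ω =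
        A 0 ω * perpetuityTerm (fun k => A (k + 1)) (fun k => B (k + 1)) k ω := by
      simp only [perpetuityTerm, Finset.prod_range_succ']
      ring
    rw [Finset.sum_range_succ', Finset.prod_range_succ', Finset.sum_congr rfl fun k _ => hshift k,
      ← Finset.mul_sum]
    simp only [backwardChain, ih, perpetuityTerm, Finset.prod_range_zero]
    ring

theorem tendsto_backwardChain {Ω : Type*} {A B : ℕ → Ω → ℝ} (X₀ : Ω → ℝ) {ω : Ω}
    (hS : Summable fun k => perpetuityTerm A B k ω)
    (hprod : Tendsto (fun n => ∏ j ∈ Finset.range n, A j ω) atTop (𝓝 0)) :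
    Tendsto (fun n => backwardChain A B X₀ n ω) atTop (𝓝 (perpetuity A B ω)) := by
  simp only [backwardChain_eq_sum_perpetuityTerm_add]
  simpa [perpetuity] using hS.hasSum.tendsto_sum_nat.add (hprod.mul_const (X₀ ω))

theorem affineChain_succ' {Ω : Type*} (A B : ℕ → Ω → ℝ) (X₀ : Ω → ℝ) (n : ℕ) :
    affineChain A B X₀ (n + 1) =
      affineChain (fun k => A (k + 1)) (fun k => B (k + 1)) (fun ω => A 0 ω * X₀ ω + B 0 ω) n := by
  induction n with
  | zero => rfl
  | succ n ih => rw [affineChain, ih, affineChain]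

namespace IsIIDPairs

variable {Ω : Type*} [MeasurableSpace Ω] {P : Measure Ω}
  {A B : ℕ → Ω → ℝ} {κ : ProbabilityMeasure (ℝ × ℝ)} {X₀ : Ω → ℝ} {μ₀ ν : ProbabilityMeasure ℝ}

theorem shift (h : IsIIDPairs A B κ P) :
    IsIIDPairs (fun n => A (n + 1)) (fun n => B (n + 1)) κ P where
  measurable_pair n := h.measurable_pair (n + 1)
  iIndepFun := h.iIndepFun.precomp (add_left_injective 1)
  hasLaw n := h.hasLaw (n + 1)

theorem measurable_seq (h : IsIIDPairs A B κ P) : Measurable fun ω n => (A n ω, B n ω) :=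
  measurable_pi_lambda _ h.measurable_pair

theorem indepFun_zero_shift (h : IsIIDPairs A B κ P) :
    IndepFun (fun ω => (A 0 ω, B 0 ω)) (fun ω n => (A (n + 1) ω, B (n + 1) ω)) P := by
  have hindep := indep_iSup_of_disjoint (fun i => (h.measurable_pair i).comap_le) h.iIndepFun
    (S := {0}) (T := {0}ᶜ) disjoint_compl_right
  refine indep_of_indep_of_le_left (indep_of_indep_of_le_right hindep ?_) ?_
  · refine Measurable.comap_le (@measurable_pi_lambda _ _ _ (_) _ _ fun n => ?_)
    exact measurable_iff_comap_le.2 (le_iSup₂_of_le (n + 1) (Nat.succ_ne_zero n) le_rfl)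
  · exact le_iSup₂_of_le 0 rfl le_rfl

theorem comp_measurePreserving {Ω' : Type*} [MeasurableSpace Ω'] {P' : Measure Ω'} {φ : Ω' → Ω}
    (h : IsIIDPairs A B κ P) (hφ : MeasurePreserving φ P' P) :
    IsIIDPairs (fun n => A n ∘ φ) (fun n => B n ∘ φ) κ P' where
  measurable_pair n := (h.measurable_pair n).comp hφ.measurable
  iIndepFun := by
    refine iIndepFun_iff_measure_inter_preimage_eq_mul.2 fun S s hs => ?_
    have hpre (i : ℕ) (hi : i ∈ S) : MeasurableSet ((fun ω => (A i ω, B i ω)) ⁻¹' s i) :=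
      h.measurable_pair i (hs i hi)
    calc P' (⋂ i ∈ S, (fun ω => (A i (φ ω), B i (φ ω))) ⁻¹' s i)
        = P' (φ ⁻¹' ⋂ i ∈ S, (fun ω => (A i ω, B i ω)) ⁻¹' s i) := by
          simp only [Set.preimage_iInter₂, Set.preimage_preimage]
      _ = ∏ i ∈ S, P ((fun ω => (A i ω, B i ω)) ⁻¹' s i) := by
          rw [hφ.measure_preimage (S.measurableSet_biInter hpre).nullMeasurableSet,
            h.iIndepFun.measure_inter_preimage_eq_mul S hs]
      _ = _ := Finset.prod_congr rfl fun i hi =>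
          (hφ.measure_preimage (hpre i hi).nullMeasurableSet).symm
  hasLaw n := (h.hasLaw n).comp hφ.hasLaw

theorem aemeasurable_perpetuity (h : IsIIDPairs A B κ P)
    (hS : ∀ᵐ ω ∂P, Summable fun k => perpetuityTerm A B k ω) :
    AEMeasurable (perpetuity A B) P := by
  have hA (n : ℕ) : Measurable (A n) := (h.measurable_pair n).fst
  have hB (n : ℕ) : Measurable (B n) := (h.measurable_pair n).snd
  refine aemeasurable_of_tendsto_metrizable_ae atTop
    (f := fun n ω => ∑ k ∈ Finset.range n, perpetuityTerm A B k ω) (fun n => ?_) ?_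
  · unfold perpetuityTerm
    fun_prop
  · filter_upwards [hS] with ω hω using hω.hasSum.tendsto_sum_nat

variable [IsProbabilityMeasure P]

theorem hasLaw_affine (h : IsIIDPairs A B κ P) (hX₀ : HasLaw X₀ μ₀ P)
    (hX₀_indep : IndepFun (fun ω => (A 0 ω, B 0 ω)) X₀ P) :
    HasLaw (fun ω => A 0 ω * X₀ ω + B 0 ω) (affineStep κ μ₀) P :=
  HasLaw.comp (Y := fun p : (ℝ × ℝ) × ℝ => p.1.1 * p.2 + p.1.2) ⟨by fun_prop, rfl⟩
    (hX₀_indep.hasLaw_prod (h.hasLaw 0) hX₀)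

theorem hasLaw_affineChain (h : IsIIDPairs A B κ P) (hX₀ : HasLaw X₀ μ₀ P)
    (hX₀_indep : IndepFun X₀ (fun ω n => (A n ω, B n ω)) P) (n : ℕ) :
    HasLaw (affineChain A B X₀ n) ((affineStep κ)^[n] μ₀) P := by
  induction n generalizing A B X₀ μ₀ with
  | zero => exact hX₀
  | succ n ih =>
    have hX₀_pair : IndepFun (fun ω => (A 0 ω, B 0 ω)) X₀ P :=
      (hX₀_indep.comp measurable_id (measurable_pi_apply 0)).symm
    rw [affineChain_succ', Function.iterate_succ_apply]
    refine ih h.shift (h.hasLaw_affine hX₀ hX₀_pair) ?_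
    exact (indepFun_prodMk_of_indepFun_prodMk_right hX₀.aemeasurable (h.hasLaw 0).aemeasurable
      h.shift.measurable_seq.aemeasurable (indepFun_prodMk_zero_shift hX₀_indep)
      h.indepFun_zero_shift).comp (φ := fun p : ℝ × (ℝ × ℝ) => p.2.1 * p.1 + p.2.2) (by fun_prop)
      measurable_id

theorem hasLaw_backwardChain (h : IsIIDPairs A B κ P) (hX₀ : HasLaw X₀ μ₀ P)
    (hX₀_indep : IndepFun X₀ (fun ω n => (A n ω, B n ω)) P) (n : ℕ) :
    HasLaw (backwardChain A B X₀ n) ((affineStep κ)^[n] μ₀) P := by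
  induction n generalizing A B with
  | zero => exact hX₀
  | succ n ih =>
    have hX₀_shift : IndepFun X₀ (fun ω n => (A (n + 1) ω, B (n + 1) ω)) P :=
      (indepFun_prodMk_zero_shift hX₀_indep).comp measurable_id measurable_snd
    rw [Function.iterate_succ_apply']
    refine h.hasLaw_affine (ih h.shift hX₀_shift) (IndepFun.symm ?_)
    have hpair := indepFun_prodMk_of_indepFun_prodMk_right hX₀.aemeasurable
      h.shift.measurable_seq.aemeasurable (h.hasLaw 0).aemeasurable
      ((indepFun_prodMk_zero_shift hX₀_indep).comp measurable_id measurable_swap)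
      h.indepFun_zero_shift.symm
    have hmeas := measurable_backwardChain (A := fun k (p : ℝ × (ℕ → ℝ × ℝ)) => (p.2 k).1)
      (B := fun k p => (p.2 k).2) (X₀ := Prod.fst) (by fun_prop) (by fun_prop) (by fun_prop) n
    have hpair' := hpair.comp hmeas measurable_id
    rwa [← backwardChain_comp] at hpair'

/-- Letac's principle: the backward iterates have the same laws as the Markov chain, but they
converge almost surely. -/
theorem tendsto_iterate_affineStep (h : IsIIDPairs A B κ P)
    (hS : ∀ᵐ ω ∂P, Summable fun k => perpetuityTerm A B k ω)
    (hprod : ∀ᵐ ω ∂P, Tendsto (fun n => ∏ j ∈ Finset.range n, A j ω) atTop (𝓝 0))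
    (hX : HasLaw (perpetuity A B) ν P) (μ₀ : ProbabilityMeasure ℝ) :
    Tendsto (fun n => (affineStep κ)^[n] μ₀) atTop (𝓝 ν) := by
  have hfst : MeasurePreserving Prod.fst (P.prod (μ₀ : Measure ℝ)) P := measurePreserving_fst
  have hsnd : HasLaw Prod.snd μ₀ (P.prod (μ₀ : Measure ℝ)) := measurePreserving_snd.hasLaw
  have hindep : IndepFun Prod.snd (fun p n => (A n p.1, B n p.1)) (P.prod (μ₀ : Measure ℝ)) :=
    (indepFun_prod h.measurable_seq measurable_id).symm
  have hlaw := (h.comp_measurePreserving hfst).hasLaw_backwardChain hsnd hindep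
  have hX' : HasLaw (perpetuity (fun n => A n ∘ Prod.fst) (fun n => B n ∘ Prod.fst)) ν
      (P.prod (μ₀ : Measure ℝ)) := hX.comp hfst.hasLaw
  refine (tendstoInDistribution_iff_of_hasLaw hlaw hX').1 <|
    tendstoInDistribution_of_ae_tendsto (fun n => (hlaw n).aemeasurable) hX'.aemeasurable ?_
  filter_upwards [hfst.quasiMeasurePreserving.ae hS, hfst.quasiMeasurePreserving.ae hprod]
    with p hp_summable hp_prod
  exact tendsto_backwardChain _ hp_summable hp_prod

theorem tendstoInDistribution_affineChain (h : IsIIDPairs A B κ P)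
    (hS : ∀ᵐ ω ∂P, Summable fun k => perpetuityTerm A B k ω)
    (hprod : ∀ᵐ ω ∂P, Tendsto (fun n => ∏ j ∈ Finset.range n, A j ω) atTop (𝓝 0))
    (hX₀ : AEMeasurable X₀ P) (hX₀_indep : IndepFun X₀ (fun ω n => (A n ω, B n ω)) P) :
    TendstoInDistribution (affineChain A B X₀) atTop (perpetuity A B) (fun _ => P) P := by
  obtain ⟨μ₀, hX₀_law⟩ := exists_probabilityMeasure_hasLaw hX₀
  obtain ⟨ν, hX⟩ := exists_probabilityMeasure_hasLaw (h.aemeasurable_perpetuity hS)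
  exact (tendstoInDistribution_iff_of_hasLaw (h.hasLaw_affineChain hX₀_law hX₀_indep) hX).2
    (h.tendsto_iterate_affineStep hS hprod hX μ₀)

end IsIIDPairs

theorem isStationaryLaw_of_tendsto_iterate_affineStep {κ : ProbabilityMeasure (ℝ × ℝ)}
    {μ₀ ν : ProbabilityMeasure ℝ} (h : Tendsto (fun n => (affineStep κ)^[n] μ₀) atTop (𝓝 ν)) :
    IsStationaryLaw (κ : Measure (ℝ × ℝ)) (ν : Measure ℝ) :=
  isStationaryLaw_iff_isFixedPt_affineStep.2 <|
    isFixedPt_of_tendsto_iterate h (continuous_affineStep κ).continuousAt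

theorem IsStationaryLaw.eq_of_tendsto_iterate_affineStep {κ : ProbabilityMeasure (ℝ × ℝ)}
    {μ ν : ProbabilityMeasure ℝ} (hμ : IsStationaryLaw (κ : Measure (ℝ × ℝ)) (μ : Measure ℝ))
    (h : Tendsto (fun n => (affineStep κ)^[n] μ) atTop (𝓝 ν)) : μ = ν := by
  have hfixed := isStationaryLaw_iff_isFixedPt_affineStep.1 hμ
  simp only [(hfixed.iterate _).eq] at h
  exact tendsto_nhds_unique tendsto_const_nhds h

section Moments

variable {Ω E : Type*} [MeasurableSpace Ω] [MeasurableSpace E] {P : Measure Ω} {U : ℕ → Ω → E}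
  {μ : Measure E} {f g : E → ℝ≥0∞}

theorem lintegral_prod_range_mul_of_iIndepFun (hU : iIndepFun U P)
    (hU_law : ∀ n, HasLaw (U n) μ P) (hU_meas : ∀ n, Measurable (U n)) (hf : Measurable f)
    (hg : Measurable g) (n : ℕ) :
    ∫⁻ ω, (∏ j ∈ Finset.range n, f (U j ω)) * g (U n ω) ∂P = (∫⁻ x, f x ∂μ) ^ n * ∫⁻ x, g x ∂μ := by
  let F (i : ℕ) : E → ℝ≥0∞ := if i < n then f else g
  have hF (i : ℕ) : Measurable (F i) := by unfold F; split_ifs <;> assumption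
  have hprod {a : (E → ℝ≥0∞) → ℕ → ℝ≥0∞} :
      ∏ i ∈ Finset.range (n + 1), a (F i) i = (∏ j ∈ Finset.range n, a f j) * a g n := by
    rw [Finset.prod_range_succ]
    congr 1
    · exact Finset.prod_congr rfl fun j hj => by simp only [F, Finset.mem_range.1 hj, if_true]
    · simp only [F, lt_irrefl, if_false]
  calc ∫⁻ ω, (∏ j ∈ Finset.range n, f (U j ω)) * g (U n ω) ∂P
      = ∫⁻ ω, ∏ i ∈ Finset.range (n + 1), F i (U i ω) ∂P :=
        lintegral_congr fun ω => (hprod (a := fun φ j => φ (U j ω))).symm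
    _ = ∏ i ∈ Finset.range (n + 1), ∫⁻ ω, F i (U i ω) ∂P :=
        lintegral_prod_eq_prod_lintegral_of_indepFun _ _ (hU.comp F hF)
          fun i => (hF i).comp (hU_meas i)
    _ = ∏ i ∈ Finset.range (n + 1), ∫⁻ x, F i x ∂μ :=
        Finset.prod_congr rfl fun i _ => (hU_law i).lintegral_comp (hF i).aemeasurable
    _ = (∫⁻ x, f x ∂μ) ^ n * ∫⁻ x, g x ∂μ := by
        rw [hprod (a := fun φ _ => ∫⁻ x, φ x ∂μ), Finset.prod_const, Finset.card_range]

theorem ae_tsum_prod_range_mul_lt_top_of_iIndepFun (hU : iIndepFun U P)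
    (hU_law : ∀ n, HasLaw (U n) μ P) (hU_meas : ∀ n, Measurable (U n)) (hf : Measurable f)
    (hg : Measurable g) (hf_lt : ∫⁻ x, f x ∂μ < 1) (hg_fin : ∫⁻ x, g x ∂μ ≠ ∞) :
    ∀ᵐ ω ∂P, ∑' n, (∏ j ∈ Finset.range n, f (U j ω)) * g (U n ω) < ∞ := by
  have hmeas (n : ℕ) : Measurable fun ω => (∏ j ∈ Finset.range n, f (U j ω)) * g (U n ω) := by
    fun_prop
  refine ae_lt_top (Measurable.tsum hmeas) ?_
  rw [lintegral_tsum fun n => (hmeas n).aemeasurable]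
  simp only [lintegral_prod_range_mul_of_iIndepFun hU hU_law hU_meas hf hg]
  rw [ENNReal.tsum_mul_right, ENNReal.tsum_geometric]
  exact ENNReal.mul_ne_top (ENNReal.inv_ne_top.2 (tsub_pos_of_lt hf_lt).ne') hg_fin

end Moments

theorem summable_of_tsum_enorm_rpow_ne_top {ι E : Type*} [NormedAddCommGroup E] [CompleteSpace E]
    {x : ι → E} {δ : ℝ} (hδ : 0 < δ) (hδ1 : δ ≤ 1) (h : ∑' k, ‖x k‖ₑ ^ δ ≠ ∞) : Summable x := by
  refine Summable.of_norm_bounded_eventually (ENNReal.summable_toReal h) ?_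
  filter_upwards [(ENNReal.tendsto_cofinite_zero_of_tsum_ne_top h).eventually
    (gt_mem_nhds zero_lt_one)] with k hk
  have hle_one : ‖x k‖ₑ ≤ 1 := by
    by_contra! hgt
    exact hk.not_ge (ENNReal.one_le_rpow hgt.le hδ)
  have hle_rpow : ‖x k‖ₑ ≤ ‖x k‖ₑ ^ δ := by
    simpa only [ENNReal.rpow_one] using ENNReal.rpow_le_rpow_of_exponent_ge hle_one hδ1
  simpa only [toReal_enorm] using ENNReal.toReal_mono hk.ne_top hle_rpow

theorem enorm_prod_rpow {ι R : Type*} [NormedField R] (s : Finset ι) (x : ι → R) {δ : ℝ}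
    (hδ : 0 ≤ δ) : ‖∏ i ∈ s, x i‖ₑ ^ δ = ∏ i ∈ s, ‖x i‖ₑ ^ δ := by
  rw [ENNReal.prod_rpow_of_nonneg hδ]
  simp only [enorm_eq_nnnorm, nnnorm_prod, ENNReal.ofNNReal_finsetProd]

namespace IsIIDPairs

variable {Ω : Type*} [MeasurableSpace Ω] {P : Measure Ω} {A B : ℕ → Ω → ℝ}
  {κ : ProbabilityMeasure (ℝ × ℝ)} {δ : ℝ}

theorem ae_summable_perpetuityTerm (h : IsIIDPairs A B κ P) (hδ : 0 < δ) (hδ1 : δ ≤ 1)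
    (hA : ∫⁻ p, ‖p.1‖ₑ ^ δ ∂(κ : Measure (ℝ × ℝ)) < 1)
    (hB : ∫⁻ p, ‖p.2‖ₑ ^ δ ∂(κ : Measure (ℝ × ℝ)) ≠ ∞) :
    ∀ᵐ ω ∂P, Summable fun k => perpetuityTerm A B k ω := by
  filter_upwards [ae_tsum_prod_range_mul_lt_top_of_iIndepFun h.iIndepFun h.hasLaw h.measurable_pair
    (measurable_fst.enorm.pow_const δ) (measurable_snd.enorm.pow_const δ) hA hB] with ω hω
  refine summable_of_tsum_enorm_rpow_ne_top hδ hδ1 ?_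
  simpa only [perpetuityTerm, enorm_mul, ENNReal.mul_rpow_of_nonneg _ _ hδ.le,
    enorm_prod_rpow _ _ hδ.le, mul_comm] using hω.ne

theorem ae_tendsto_prod_range_zero (h : IsIIDPairs A B κ P) (hδ : 0 < δ) (hδ1 : δ ≤ 1)
    (hA : ∫⁻ p, ‖p.1‖ₑ ^ δ ∂(κ : Measure (ℝ × ℝ)) < 1) :
    ∀ᵐ ω ∂P, Tendsto (fun n => ∏ j ∈ Finset.range n, A j ω) atTop (𝓝 0) := by
  filter_upwards [ae_tsum_prod_range_mul_lt_top_of_iIndepFun h.iIndepFun h.hasLaw h.measurable_pair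
    (measurable_fst.enorm.pow_const δ) (measurable_const (a := 1)) hA (by simp)] with ω hω
  refine (summable_of_tsum_enorm_rpow_ne_top hδ hδ1 ?_).tendsto_atTop_zero
  simpa only [enorm_prod_rpow _ _ hδ.le, mul_one] using hω.ne

end IsIIDPairs

theorem lintegral_enorm_rpow_lt_one_of_le {Ω E : Type*} [MeasurableSpace Ω] {P : Measure Ω}
    [IsProbabilityMeasure P] [NormedAddCommGroup E] {f : Ω → E} (hf : AEStronglyMeasurable f P)
    {δ α : ℝ} (hδ : 0 < δ) (hδα : δ ≤ α) (h : ∫⁻ ω, ‖f ω‖ₑ ^ α ∂P < 1) :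
    ∫⁻ ω, ‖f ω‖ₑ ^ δ ∂P < 1 := by
  have hα : 0 < α := hδ.trans_le hδα
  rw [lintegral_rpow_enorm_eq_rpow_eLpNorm' hα, ← ENNReal.one_rpow α,
    ENNReal.rpow_lt_rpow_iff hα] at h
  rw [lintegral_rpow_enorm_eq_rpow_eLpNorm' hδ]
  exact ENNReal.rpow_lt_one ((eLpNorm'_le_eLpNorm'_of_exponent_le hδ hδα P hf).trans_lt h) hδ

theorem lintegral_enorm_rpow_eq_ofReal_integral {Ω : Type*} [MeasurableSpace Ω] {P : Measure Ω}
    {a : Ω → ℝ} {α : ℝ} (hα : 0 ≤ α) (ha : ∀ᵐ ω ∂P, 0 ≤ a ω)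
    (hint : Integrable (fun ω => a ω ^ α) P) :
    ∫⁻ ω, ‖a ω‖ₑ ^ α ∂P = ENNReal.ofReal (∫ ω, a ω ^ α ∂P) := by
  rw [ofReal_integral_eq_lintegral_ofReal hint (ha.mono fun ω hω => Real.rpow_nonneg hω α)]
  refine lintegral_congr_ae ?_
  filter_upwards [ha] with ω hω
  rw [Real.enorm_of_nonneg hω, ENNReal.ofReal_rpow_of_nonneg hω hα]

theorem lintegral_enorm_rpow_le_of_tail_le {Ω Ω' E F : Type*} [MeasurableSpace Ω]
    [MeasurableSpace Ω'] [NormedAddCommGroup E] [NormedAddCommGroup F] {P : Measure Ω}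
    {Q : Measure Ω'} {f : Ω → E} {g : Ω' → F} (hf : AEStronglyMeasurable f P)
    (hg : AEStronglyMeasurable g Q) {C : ℝ≥0∞}
    (h : ∀ t, P {ω | t < ‖f ω‖} ≤ C * Q {ω | t < ‖g ω‖}) {δ : ℝ} (hδ : 0 < δ) :
    ∫⁻ ω, ‖f ω‖ₑ ^ δ ∂P ≤ C * ∫⁻ ω, ‖g ω‖ₑ ^ δ ∂Q := by
  have htail : Measurable fun t : ℝ => Q {ω | t < ‖g ω‖} :=
    Antitone.measurable fun s t hst => measure_mono fun ω (hω : t < ‖g ω‖) => hst.trans_lt hω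
  have hdensity : Measurable fun t : ℝ => Q {ω | t < ‖g ω‖} * ENNReal.ofReal (t ^ (δ - 1)) :=
    htail.mul (by fun_prop)
  simp only [← ofReal_norm, ENNReal.ofReal_rpow_of_nonneg (norm_nonneg _) hδ.le]
  rw [lintegral_rpow_eq_lintegral_meas_lt_mul P (ae_of_all _ fun _ => norm_nonneg _)
      hf.norm.aemeasurable hδ,
    lintegral_rpow_eq_lintegral_meas_lt_mul Q (ae_of_all _ fun _ => norm_nonneg _)
      hg.norm.aemeasurable hδ, mul_left_comm, ← lintegral_const_mul C hdensity]
  refine mul_le_mul_right (lintegral_mono fun t => ?_) _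
  rw [← mul_assoc]
  exact mul_le_mul_left (h t) _

theorem limsup_div_lt_top_iff_isBigO_toReal {ι : Type*} {l : Filter ι} {f g : ι → ℝ≥0∞}
    (hf : ∀ i, f i ≠ ∞) (hg : ∀ i, g i ≠ ∞) :
    limsup (fun i => f i / g i) l < ∞ ↔ (fun i => (f i).toReal) =O[l] fun i => (g i).toReal := by
  refine ⟨fun h => ?_, fun h => ?_⟩
  · obtain ⟨C, hC, hC_top⟩ := exists_between h
    refine IsBigO.of_bound C.toReal ?_
    filter_upwards [eventually_lt_of_limsup_lt hC] with i hi
    have hle : f i ≤ C * g i :=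
      (ENNReal.div_le_iff_le_mul (Or.inr hC_top.ne) (Or.inl (hg i))).1 hi.le
    rw [Real.norm_of_nonneg ENNReal.toReal_nonneg, Real.norm_of_nonneg ENNReal.toReal_nonneg,
      ← ENNReal.toReal_mul]
    exact ENNReal.toReal_mono (ENNReal.mul_ne_top hC_top.ne (hg i)) hle
  · obtain ⟨C, hC, hbound⟩ := h.exists_pos
    refine (limsup_le_of_le (by isBoundedDefault) ?_).trans_lt (ENNReal.ofReal_lt_top (r := C))
    filter_upwards [hbound.bound] with i hi
    rw [Real.norm_of_nonneg ENNReal.toReal_nonneg, Real.norm_of_nonneg ENNReal.toReal_nonneg] at hi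
    refine ENNReal.div_le_of_le_mul ?_
    rw [← ENNReal.ofReal_toReal (hf i), ← ENNReal.ofReal_toReal (hg i), ← ENNReal.ofReal_mul hC.le]
    exact ENNReal.ofReal_le_ofReal hi

theorem weaklyEquiv_iff_isTheta_toReal {f g : ℝ → ℝ≥0∞} (hf : ∀ t, f t ≠ ∞) (hg : ∀ t, g t ≠ ∞)
    (hg0 : ∀ t, g t ≠ 0) :
    WeaklyEquiv f g ↔ (fun t => (f t).toReal) =Θ[atTop] fun t => (g t).toReal := by
  have hinv : (fun t => f t / g t) = fun t => (g t / f t)⁻¹ :=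
    funext fun t => (ENNReal.inv_div (Or.inr (hg t)) (Or.inr (hg0 t))).symm
  rw [WeaklyEquiv, limsup_div_lt_top_iff_isBigO_toReal hf hg, hinv, ← ENNReal.inv_limsup,
    ENNReal.inv_pos, ← lt_top_iff_ne_top, limsup_div_lt_top_iff_isBigO_toReal hg hf, and_comm]
  rfl

theorem exists_forall_le_mul_of_limsup_div_lt_top {f g : ℝ → ℝ≥0∞} (hf : ∀ t, f t ≤ 1)
    (hg : Antitone g) (hg_top : ∀ t, g t ≠ ∞) (hg0 : ∀ t, g t ≠ 0)
    (h : limsup (fun t => f t / g t) atTop < ∞) :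
    ∃ C : ℝ≥0∞, C ≠ ∞ ∧ ∀ t, f t ≤ C * g t := by
  obtain ⟨C, hC, hC_top⟩ := exists_between h
  obtain ⟨T, hT⟩ := eventually_atTop.1 (eventually_lt_of_limsup_lt hC)
  refine ⟨C + (g T)⁻¹, ENNReal.add_ne_top.2 ⟨hC_top.ne, ENNReal.inv_ne_top.2 (hg0 T)⟩, fun t => ?_⟩
  rcases le_total T t with ht | ht
  · calc f t ≤ C * g t := (ENNReal.div_le_iff (hg0 t) (hg_top t)).1 (hT t ht).le
      _ ≤ (C + (g T)⁻¹) * g t := by gcongr; exact le_self_add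
  · calc f t ≤ (g T)⁻¹ * g T := (hf t).trans_eq (ENNReal.inv_mul_cancel (hg0 T) (hg_top T)).symm
      _ ≤ (C + (g T)⁻¹) * g t := by gcongr; exacts [le_add_self, hg ht]

theorem AsympEq.tendsto_div_of_const_mul {g h : ℝ → ℝ} {c : ℝ} (hc : c ≠ 0)
    (H : AsympEq g fun t => c * h t) : Tendsto (fun t => g t / h t) atTop (𝓝 c) := by
  have hlim : Tendsto (fun t => c * (g t / (c * h t))) atTop (𝓝 (c * 1)) := H.const_mul c
  rw [mul_one] at hlim
  refine hlim.congr fun t => ?_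
  rw [← mul_div_assoc, mul_div_mul_left _ _ hc]

/-- Regular variation of index `-α` of the tail `t ↦ P(a > t)`. -/
def RegularlyVaryingTail {Ω : Type*} [MeasurableSpace Ω] (P : Measure Ω) (a : Ω → ℝ) (α : ℝ) :
    Prop :=
  ∀ y : ℝ, 0 < y →
    AsympEq (fun t => P.real {ω | t * y < a ω}) fun t => y ^ (-α) * P.real {ω | t < a ω}

section Tails

variable {Ω : Type*} [MeasurableSpace Ω]

theorem antitone_measure_setOf_lt (P : Measure Ω) (a : Ω → ℝ) :
    Antitone fun t => P {ω | t < a ω} :=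
  fun _ _ hst => measure_mono fun _ hω => hst.trans_lt hω

theorem antitone_measureReal_setOf_lt (P : Measure Ω) [IsFiniteMeasure P] (a : Ω → ℝ) :
    Antitone fun t => P.real {ω | t < a ω} :=
  fun _ _ hst => ENNReal.toReal_mono (measure_ne_top _ _) (antitone_measure_setOf_lt P a hst)

theorem tendsto_measureReal_setOf_lt_zero {P : Measure Ω} [IsFiniteMeasure P] {a : Ω → ℝ}
    (ha : Measurable a) :
    Tendsto (fun t => P.real {ω | t < a ω}) atTop (𝓝 0) := by
  have hempty : ⋂ t : ℝ, {ω | t < a ω} = ∅ :=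
    Set.iInter_eq_empty_iff.2 fun ω => ⟨a ω, lt_irrefl (a ω)⟩
  have hlim := tendsto_measure_iInter_atTop (μ := P) (s := fun t : ℝ => {ω | t < a ω})
    (fun _ => (measurableSet_lt measurable_const ha).nullMeasurableSet)
    (fun _ _ hst _ hω => hst.trans_lt hω) ⟨0, measure_ne_top _ _⟩
  rw [hempty, measure_empty] at hlim
  exact (ENNReal.tendsto_toReal ENNReal.zero_ne_top).comp hlim

end Tails

namespace RegularlyVaryingTail

variable {Ω : Type*} [MeasurableSpace Ω] {P : Measure Ω} {a : Ω → ℝ} {α : ℝ}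

theorem tendsto_div (h : RegularlyVaryingTail P a α) {y : ℝ} (hy : 0 < y) :
    Tendsto (fun t => P.real {ω | t * y < a ω} / P.real {ω | t < a ω}) atTop (𝓝 (y ^ (-α))) :=
  (h y hy).tendsto_div_of_const_mul (Real.rpow_pos_of_pos hy _).ne'

theorem isTheta_mul_const (h : RegularlyVaryingTail P a α) {y : ℝ} (hy : 0 < y) :
    (fun t => P.real {ω | t * y < a ω}) =Θ[atTop] fun t => P.real {ω | t < a ω} :=
  (isTheta_of_div_tendsto_nhds_ne_zero (h.tendsto_div hy) (Real.rpow_pos_of_pos hy _).ne').symm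

variable [IsFiniteMeasure P]

theorem measureReal_pos (h : RegularlyVaryingTail P a α) (t : ℝ) : 0 < P.real {ω | t < a ω} := by
  have hone : (1 : ℝ) ^ (-α) ≠ 0 := by simp
  obtain ⟨s, hs, hts⟩ :=
    (((h.tendsto_div one_pos).eventually_ne hone).and (eventually_ge_atTop t)).exists
  refine lt_of_lt_of_le ?_ (antitone_measureReal_setOf_lt P a hts)
  exact measureReal_nonneg.lt_of_ne fun hzero => hs (by simp [← hzero])

theorem measure_ne_zero (h : RegularlyVaryingTail P a α) (t : ℝ) : P {ω | t < a ω} ≠ 0 :=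
  (ENNReal.toReal_pos_iff.1 (h.measureReal_pos t)).1.ne'

end RegularlyVaryingTail

theorem exists_lintegral_rpow_lt_one_and_ne_top {Ω : Type*} [MeasurableSpace Ω] {P : Measure Ω}
    [IsProbabilityMeasure P] {a b : Ω → ℝ} {α : ℝ} (hα : 0 < α) (ha0 : ∀ᵐ ω ∂P, 0 < a ω)
    (hint : Integrable (fun ω => a ω ^ α) P) (hm : ∫ ω, a ω ^ α ∂P < 1)
    (htail : ∀ t, P {ω | t < a ω} ≠ 0)
    (hb : limsup (fun t => P {ω | t < |b ω|} / P {ω | t < a ω}) atTop < ∞)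
    {κ : ProbabilityMeasure (ℝ × ℝ)} (hab : HasLaw (fun ω => (a ω, b ω)) κ P) :
    ∃ δ : ℝ, 0 < δ ∧ δ ≤ 1 ∧ ∫⁻ p, ‖p.1‖ₑ ^ δ ∂(κ : Measure (ℝ × ℝ)) < 1 ∧
      ∫⁻ p, ‖p.2‖ₑ ^ δ ∂(κ : Measure (ℝ × ℝ)) ≠ ∞ := by
  have ha : AEStronglyMeasurable a P := hab.aemeasurable.fst.aestronglyMeasurable
  have hb_meas : AEStronglyMeasurable b P := hab.aemeasurable.snd.aestronglyMeasurable
  have hδ : 0 < min α 1 := lt_min hα one_pos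
  have haα : ∫⁻ ω, ‖a ω‖ₑ ^ α ∂P < 1 := by
    rw [lintegral_enorm_rpow_eq_ofReal_integral hα.le (ha0.mono fun _ => le_of_lt) hint]
    exact ENNReal.ofReal_lt_one.2 hm
  have haδ := lintegral_enorm_rpow_lt_one_of_le ha hδ (min_le_left α 1) haα
  obtain ⟨C, hC, hbC⟩ := exists_forall_le_mul_of_limsup_div_lt_top (fun _ => prob_le_one)
    (antitone_measure_setOf_lt P a) (fun _ => measure_ne_top _ _) htail hb
  have habs (t : ℝ) : P {ω | t < a ω} ≤ P {ω | t < ‖a ω‖} :=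
    measure_mono fun ω hω => hω.trans_le (le_abs_self (a ω))
  have hbδ := lintegral_enorm_rpow_le_of_tail_le hb_meas ha
    (fun t => (hbC t).trans (mul_le_mul_right (habs t) C)) hδ
  refine ⟨min α 1, hδ, min_le_right α 1, ?_, ?_⟩
  · rwa [← hab.lintegral_comp (f := fun p => ‖p.1‖ₑ ^ min α 1) (by fun_prop)]
  · rw [← hab.lintegral_comp (f := fun p => ‖p.2‖ₑ ^ min α 1) (by fun_prop)]
    exact ne_top_of_le_ne_top (ENNReal.mul_ne_top hC haδ.ne_top) hbδ

namespace RegularlyVaryingTail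

variable {Ω Ω' : Type*} [MeasurableSpace Ω] [MeasurableSpace Ω'] {P : Measure Ω}
  [IsFiniteMeasure P] {Q : Measure Ω'} [IsFiniteMeasure Q] {a : Ω → ℝ} {c : Ω' → ℝ} {α : ℝ}

/-- Breiman's lemma for a bounded factor. -/
theorem tendsto_prod_div_of_le (h : RegularlyVaryingTail P a α) (ha : Measurable a)
    (hc : Measurable c) (hc0 : ∀ᵐ y ∂Q, 0 < c y) {K : ℝ} (hK : 0 < K) (hcK : ∀ᵐ y ∂Q, c y ≤ K) :
    Tendsto (fun t => (P.prod Q).real {p | t < a p.1 * c p.2} / P.real {ω | t < a ω}) atTop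
      (𝓝 (∫ y, c y ^ α ∂Q)) := by
  have hS (t : ℝ) : MeasurableSet {p : Ω × Ω' | t < a p.1 * c p.2} :=
    measurableSet_lt measurable_const (by fun_prop)
  have hsection (t : ℝ) : Measurable fun y => P {x | t < a x * c y} :=
    measurable_measure_prodMk_right (hS t)
  have hfubini (t : ℝ) : (P.prod Q).real {p | t < a p.1 * c p.2} =
      ∫ y, P.real {x | t < a x * c y} ∂Q := by
    simp only [Measure.real]
    rw [Measure.prod_apply_symm (hS t), integral_toReal (hsection t).aemeasurable
      (ae_of_all _ fun _ => measure_lt_top _ _)]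
    rfl
  have hscale {t z : ℝ} (hz : 0 < z) : {x | t < a x * z} = {x | t * z⁻¹ < a x} := by
    ext x
    simp only [Set.mem_ofPred_eq, ← div_eq_mul_inv, div_lt_iff₀ hz]
  simp only [hfubini, ← integral_div]
  refine tendsto_integral_filter_of_dominated_convergence (fun _ => K⁻¹ ^ (-α) + 1)
    (.of_forall fun t => ((hsection t).ennreal_toReal.div_const _).aestronglyMeasurable) ?_
    (integrable_const _) ?_
  · filter_upwards [(h.tendsto_div (inv_pos.2 hK)).eventually_le_const (lt_add_one _),
      eventually_ge_atTop 0] with t ht ht0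
    filter_upwards [hc0, hcK] with y hy hyK
    rw [Real.norm_of_nonneg (by positivity), hscale hy]
    refine le_trans ?_ ht
    gcongr ?_ / _
    exact antitone_measureReal_setOf_lt P a (by gcongr)
  · filter_upwards [hc0] with y hy
    have hrpow : c y ^ α = (c y)⁻¹ ^ (-α) := by
      rw [Real.inv_rpow hy.le, Real.rpow_neg hy.le, inv_inv]
    simpa only [hscale hy, hrpow] using h.tendsto_div (inv_pos.2 hy)

theorem tendsto_prod_restrict_div (h : RegularlyVaryingTail P a α) (ha : Measurable a)
    (hc : Measurable c) (hc0 : ∀ᵐ y ∂Q, 0 < c y) {ℓ : ℝ}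
    (hℓ : Tendsto (fun t => (P.prod Q).real {p | t < a p.1 * c p.2} / P.real {ω | t < a ω}) atTop
      (𝓝 ℓ)) {K : ℝ} (hK : 0 < K) :
    Tendsto (fun t => (P.prod (Q.restrict {y | K < c y})).real {p | t < a p.1 * c p.2} /
      P.real {ω | t < a ω}) atTop (𝓝 (ℓ - ∫ y in {y | c y ≤ K}, c y ^ α ∂Q)) := by
  have hcK : MeasurableSet {y | c y ≤ K} := measurableSet_le hc measurable_const
  have hcompl : {y | c y ≤ K}ᶜ = {y | K < c y} := by
    ext y
    simp
  have hsplit : P.prod Q =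
      P.prod (Q.restrict {y | c y ≤ K}) + P.prod (Q.restrict {y | K < c y}) := by
    rw [← Measure.prod_add, ← hcompl, Measure.restrict_add_restrict_compl hcK]
  have hlow := h.tendsto_prod_div_of_le (Q := Q.restrict {y | c y ≤ K}) ha hc
    (ae_restrict_of_ae hc0) hK (ae_restrict_mem hcK)
  refine (hℓ.sub hlow).congr fun t => ?_
  rw [hsplit, measureReal_add_apply, ← sub_div, add_sub_cancel_left]

theorem exists_eventually_le_mul_of_tendsto_div_lt_one (h : RegularlyVaryingTail P a α)
    {F : ℝ → ℝ} {ℓ : ℝ} (hF : Tendsto (fun t => F t / P.real {ω | t < a ω}) atTop (𝓝 ℓ))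
    (hℓ : ℓ < 1) :
    ∃ d > 0, ∃ q < 1, ∀ᶠ t in atTop, F (t * (1 - d)) ≤ q * P.real {ω | t < a ω} := by
  have hcont : Tendsto (fun d : ℝ => ℓ * (1 - d) ^ (-α)) (𝓝[>] 0) (𝓝 ℓ) := by
    have hcontAt : ContinuousAt (fun d : ℝ => ℓ * (1 - d) ^ (-α)) 0 :=
      continuousAt_const.mul
        ((continuousAt_const.sub continuousAt_id).rpow_const (Or.inl (by norm_num)))
    simpa [ContinuousAt] using hcontAt.mono_left nhdsWithin_le_nhds
  obtain ⟨d, hd, hd0, hd1⟩ :=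
    ((hcont.eventually_lt_const hℓ).and (Ioo_mem_nhdsGT zero_lt_one)).exists
  obtain ⟨q, hq, hq1⟩ := exists_between hd
  have hd' : 0 < 1 - d := sub_pos.2 hd1
  have hlim : Tendsto (fun t => F (t * (1 - d)) / P.real {ω | t < a ω}) atTop
      (𝓝 (ℓ * (1 - d) ^ (-α))) := by
    refine ((hF.comp (tendsto_id.atTop_mul_const hd')).mul (h.tendsto_div hd')).congr fun t => ?_
    exact div_mul_div_cancel₀ (h.measureReal_pos _).ne'
  refine ⟨d, hd0, q, hq1, ?_⟩
  filter_upwards [hlim.eventually_le_const hq] with t ht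
  exact (div_le_iff₀ (h.measureReal_pos t)).1 ht

end RegularlyVaryingTail

theorem tendsto_setIntegral_setOf_le {Ω : Type*} [MeasurableSpace Ω] {P : Measure Ω} {a f : Ω → ℝ}
    (ha : Measurable a) (hf : Integrable f P) :
    Tendsto (fun n : ℕ => ∫ ω in {ω | a ω ≤ n}, f ω ∂P) atTop (𝓝 (∫ ω, f ω ∂P)) := by
  have hunion : (⋃ n : ℕ, {ω | a ω ≤ n}) = Set.univ :=
    Set.eq_univ_of_forall fun ω => Set.mem_iUnion.2 (exists_nat_ge (a ω))
  have hlim := tendsto_setIntegral_of_monotone (μ := P) (f := f) (s := fun n : ℕ => {ω | a ω ≤ n})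
    (fun n => measurableSet_le ha measurable_const)
    (fun i j hij ω (hω : a ω ≤ i) => hω.trans (Nat.cast_le.2 hij)) hf.integrableOn
  rwa [hunion, setIntegral_univ] at hlim

namespace RegularlyVaryingTail

variable {Ω : Type*} [MeasurableSpace Ω] {P : Measure Ω} [IsProbabilityMeasure P] {a : Ω → ℝ}
  {α : ℝ}

theorem exists_prod_restrict_le (h : RegularlyVaryingTail P a α) (ha : Measurable a)
    (ha0 : ∀ᵐ ω ∂P, 0 < a ω) (hint : Integrable (fun ω => a ω ^ α) P)
    (hm : ∫ ω, a ω ^ α ∂P < 1)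
    (hconv : AsympEq (fun t => (P.prod P).real {p : Ω × Ω | t < a p.1 * a p.2})
      (fun t => 2 * (∫ ω, a ω ^ α ∂P) * P.real {ω | t < a ω})) :
    ∃ d > 0, ∃ q < 1, ∃ K, ∀ᶠ t in atTop,
      (P.prod (P.restrict {ω | K < a ω})).real {p | t * (1 - d) < a p.1 * a p.2} ≤
        q * P.real {ω | t < a ω} := by
  set m := ∫ ω, a ω ^ α ∂P
  have hm0 : 0 < m := by
    have hpos : ∀ᵐ ω ∂P, 0 < a ω ^ α := ha0.mono fun ω hω => Real.rpow_pos_of_pos hω α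
    have hnonneg : 0 ≤ᵐ[P] fun ω => a ω ^ α := hpos.mono fun _ => le_of_lt
    refine (integral_nonneg_of_ae hnonneg).lt_of_ne' fun hzero => ?_
    obtain ⟨ω, hω, hω0⟩ :=
      (hpos.and ((integral_eq_zero_iff_of_nonneg_ae hnonneg hint).1 hzero)).exists
    exact hω.ne' hω0
  obtain ⟨K, hK, hK0⟩ := (((tendsto_setIntegral_setOf_le ha hint).eventually_const_lt
    (show 2 * m - 1 < m by linarith)).and (eventually_gt_atTop 0)).exists
  have hlim := h.tendsto_prod_restrict_div ha ha ha0
    (hconv.tendsto_div_of_const_mul (by positivity)) (Nat.cast_pos.2 hK0)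
  obtain ⟨d, hd0, q, hq, hle⟩ :=
    h.exists_eventually_le_mul_of_tendsto_div_lt_one hlim (by linarith)
  exact ⟨d, hd0, q, hq, K, hle⟩

end RegularlyVaryingTail

theorem measureReal_prod_cond_le {Ω Ω' : Type*} [MeasurableSpace Ω] [MeasurableSpace Ω']
    (P : Measure Ω) [IsFiniteMeasure P] (Q : Measure Ω') [IsFiniteMeasure Q] (S : Set (Ω × Ω'))
    {s s' : Set Ω'} (hss' : s ⊆ s') :
    (P.prod Q[|s]).real S ≤ (Q.real s)⁻¹ * (P.prod (Q.restrict s')).real S := by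
  rw [ProbabilityTheory.cond, Measure.prod_smul_right, measureReal_ennreal_smul_apply,
    ENNReal.toReal_inv]
  refine mul_le_mul_of_nonneg_left ?_ (inv_nonneg.2 measureReal_nonneg)
  refine ENNReal.toReal_mono (measure_ne_top _ _) (Measure.prod_mono le_rfl ?_ _)
  exact Measure.restrict_mono hss' le_rfl

theorem measureReal_cond_setOf_lt {Ω : Type*} [MeasurableSpace Ω] {P : Measure Ω} {a : Ω → ℝ}
    (ha : Measurable a) {s t : ℝ} (hst : s ≤ t) :
    P[|{ω | s < a ω}].real {ω | t < a ω} = (P.real {ω | s < a ω})⁻¹ * P.real {ω | t < a ω} := by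
  have hsub : {ω | t < a ω} ⊆ {ω | s < a ω} := fun ω hω => hst.trans_lt hω
  rw [Measure.real, cond_apply (measurableSet_lt measurable_const ha), ENNReal.toReal_mul,
    ENNReal.toReal_inv, Set.inter_eq_self_of_subset_right hsub]
  rfl

namespace RegularlyVaryingTail

variable {Ω : Type*} [MeasurableSpace Ω] {P : Measure Ω} [IsProbabilityMeasure P] {a b : Ω → ℝ}
  {α : ℝ}

/-- Conditioning on `t₀ < a` multiplies the tail of `a` by `1 / P(a > t₀)`, so that in the drift
inequality the contribution of `b` is multiplied by `P(a > t₀)`, hence negligible for large `t₀`. -/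
theorem exists_cond_drift (h : RegularlyVaryingTail P a α) (ha : Measurable a)
    (ha0 : ∀ᵐ ω ∂P, 0 < a ω) (hint : Integrable (fun ω => a ω ^ α) P)
    (hm : ∫ ω, a ω ^ α ∂P < 1)
    (hconv : AsympEq (fun t => (P.prod P).real {p : Ω × Ω | t < a p.1 * a p.2})
      (fun t => 2 * (∫ ω, a ω ^ α ∂P) * P.real {ω | t < a ω}))
    (hb : (fun t => P.real {ω | t < |b ω|}) =O[atTop] fun t => P.real {ω | t < a ω}) :
    ∃ d, ∃ t₀ ≥ 0, ∀ t, t₀ ≤ t →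
      (P.prod P[|{ω | t₀ < a ω}]) {p | t * (1 - d) < a p.1 * a p.2} +
        P {ω | t * d < |b ω|} ≤ P[|{ω | t₀ < a ω}] {ω | t < a ω} := by
  obtain ⟨d, hd0, q, hq, K, hprod⟩ := h.exists_prod_restrict_le ha ha0 hint hm hconv
  obtain ⟨D, hD⟩ :=
    ((hb.comp_tendsto (tendsto_id.atTop_mul_const hd0)).trans (h.isTheta_mul_const hd0).1).bound
  have hsmall : ∀ᶠ t₀ in atTop, D * P.real {ω | t₀ < a ω} ≤ 1 - q := by
    refine ((tendsto_measureReal_setOf_lt_zero ha).const_mul D).eventually_le_const ?_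
    rw [mul_zero]
    exact sub_pos.2 hq
  obtain ⟨T, hT⟩ := eventually_atTop.1 (hprod.and hD)
  obtain ⟨t₀, hsmall₀, ht₀, hKt₀, hTt₀⟩ := (hsmall.and ((eventually_ge_atTop 0).and
    ((eventually_ge_atTop K).and (eventually_ge_atTop T)))).exists
  refine ⟨d, t₀, ht₀, fun t ht => ?_⟩
  obtain ⟨hprod_t, hb_t⟩ := hT t (hTt₀.trans ht)
  simp only [Function.comp_apply, id, Real.norm_of_nonneg measureReal_nonneg] at hb_t
  have hG := h.measureReal_pos t
  have hG₀ := h.measureReal_pos t₀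
  have hsub : {ω | t₀ < a ω} ⊆ {ω | K < a ω} := fun ω hω => hKt₀.trans_lt hω
  have hprod_cond := (measureReal_prod_cond_le P P {p | t * (1 - d) < a p.1 * a p.2} hsub).trans
    (mul_le_mul_of_nonneg_left hprod_t (inv_nonneg.2 hG₀.le))
  have hb_cond : P.real {ω | t * d < |b ω|} ≤
      (P.real {ω | t₀ < a ω})⁻¹ * ((1 - q) * P.real {ω | t < a ω}) := by
    rw [le_inv_mul_iff₀ hG₀]
    calc P.real {ω | t₀ < a ω} * P.real {ω | t * d < |b ω|}
        ≤ P.real {ω | t₀ < a ω} * (D * P.real {ω | t < a ω}) := by gcongr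
      _ = D * P.real {ω | t₀ < a ω} * P.real {ω | t < a ω} := by ring
      _ ≤ (1 - q) * P.real {ω | t < a ω} := by gcongr
  rw [← ENNReal.toReal_le_toReal (by finiteness) (by finiteness),
    ENNReal.toReal_add (by finiteness) (by finiteness)]
  change _ + P.real _ ≤ P[|_].real _
  rw [measureReal_cond_setOf_lt ha ht]
  exact (add_le_add hprod_cond hb_cond).trans_eq (by ring)

end RegularlyVaryingTail

theorem measure_prod_setOf_lt_mul_mono {Ω Ω' Ω'' : Type*} [MeasurableSpace Ω]
    [MeasurableSpace Ω'] [MeasurableSpace Ω''] {P : Measure Ω} {Q : Measure Ω'} [SFinite Q]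
    {R : Measure Ω''} [SFinite R] {a : Ω → ℝ} {y : Ω' → ℝ} {z : Ω'' → ℝ}
    (ha : Measurable a) (ha0 : ∀ᵐ ω ∂P, 0 < a ω) (hy : Measurable y) (hz : Measurable z)
    (h : ∀ s, R {ω | s < z ω} ≤ Q {ω | s < y ω}) (t : ℝ) :
    (P.prod R) {p | t < a p.1 * z p.2} ≤ (P.prod Q) {p | t < a p.1 * y p.2} := by
  rw [Measure.prod_apply (measurableSet_lt measurable_const (by fun_prop)),
    Measure.prod_apply (measurableSet_lt measurable_const (by fun_prop))]
  refine lintegral_mono_ae ?_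
  filter_upwards [ha0] with ω hω
  simpa only [Set.preimage_ofPred_eq, div_lt_iff₀' hω] using h (t / a ω)

section AffineStep

variable {Ω : Type*} [MeasurableSpace Ω] {P : Measure Ω} [IsProbabilityMeasure P] {a b : Ω → ℝ}
  {κ : ProbabilityMeasure (ℝ × ℝ)}

theorem hasLaw_affineStep_prod (hab : HasLaw (fun ω => (a ω, b ω)) κ P)
    (ν : ProbabilityMeasure ℝ) :
    HasLaw (fun q : Ω × ℝ => a q.1 * q.2 + b q.1) (affineStep κ ν) (P.prod (ν : Measure ℝ)) := by
  have hfst : HasLaw (fun q : Ω × ℝ => (a q.1, b q.1)) κ (P.prod (ν : Measure ℝ)) :=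
    hab.comp measurePreserving_fst.hasLaw
  have hsnd : HasLaw Prod.snd (ν : Measure ℝ) (P.prod (ν : Measure ℝ)) :=
    measurePreserving_snd.hasLaw
  have hindep : IndepFun (fun q : Ω × ℝ => (a q.1, b q.1)) Prod.snd (P.prod (ν : Measure ℝ)) :=
    indepFun_prod₀ hab.aemeasurable aemeasurable_id
  exact HasLaw.comp (Y := fun p : (ℝ × ℝ) × ℝ => p.1.1 * p.2 + p.1.2) ⟨by fun_prop, rfl⟩
    (hindep.hasLaw_prod hfst hsnd)

theorem IsStationaryLaw.hasLaw_affine_prod {ν : ProbabilityMeasure ℝ}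
    (hν : IsStationaryLaw (κ : Measure (ℝ × ℝ)) (ν : Measure ℝ))
    (hab : HasLaw (fun ω => (a ω, b ω)) κ P) :
    HasLaw (fun q : Ω × ℝ => a q.1 * q.2 + b q.1) ν (P.prod (ν : Measure ℝ)) := by
  have hlaw := hasLaw_affineStep_prod hab ν
  rwa [(isStationaryLaw_iff_isFixedPt_affineStep.1 hν).eq] at hlaw

variable {Ω' : Type*} [MeasurableSpace Ω'] {Q : Measure Ω'} [IsProbabilityMeasure Q] {y : Ω' → ℝ}
  {d t₀ : ℝ}

theorem affineStep_setOf_lt_abs_le (ha : Measurable a) (ha0 : ∀ᵐ ω ∂P, 0 < a ω)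
    (hab : HasLaw (fun ω => (a ω, b ω)) κ P) (hy : Measurable y) {ν : ProbabilityMeasure ℝ}
    (hν : ∀ s, (ν : Measure ℝ) {x | s < |x|} ≤ Q {ω | s < y ω}) {t : ℝ}
    (hdrift : (P.prod Q) {p | t * (1 - d) < a p.1 * y p.2} + P {ω | t * d < |b ω|} ≤
      Q {ω | t < y ω}) :
    (affineStep κ ν : Measure ℝ) {x | t < |x|} ≤ Q {ω | t < y ω} := by
  have hsplit : ∀ᵐ q ∂P.prod (ν : Measure ℝ), t < |a q.1 * q.2 + b q.1| →
      t * (1 - d) < a q.1 * |q.2| ∨ t * d < |b q.1| := by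
    filter_upwards [Measure.quasiMeasurePreserving_fst.ae ha0] with q hq ht
    by_contra! hle
    have htri := abs_add_le (a q.1 * q.2) (b q.1)
    rw [abs_mul, abs_of_pos hq] at htri
    linarith [hle.1, hle.2]
  have hmarginal : (P.prod (ν : Measure ℝ)) {q | t * d < |b q.1|} = P {ω | t * d < |b ω|} := by
    have hrect := Measure.prod_prod (μ := P) (ν := (ν : Measure ℝ)) {ω | t * d < |b ω|} Set.univ
    rwa [measure_univ, mul_one, Set.prod_univ] at hrect
  calc (affineStep κ ν : Measure ℝ) {x | t < |x|}
      = (P.prod (ν : Measure ℝ)) {q | t < |a q.1 * q.2 + b q.1|} :=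
        ((hasLaw_affineStep_prod hab ν).measure_eq (p := fun x => t < |x|)
          (measurableSet_lt measurable_const measurable_abs)).symm
    _ ≤ (P.prod (ν : Measure ℝ)) {q | t * (1 - d) < a q.1 * |q.2|} +
          (P.prod (ν : Measure ℝ)) {q | t * d < |b q.1|} :=
        (measure_mono_ae hsplit).trans (measure_union_le _ _)
    _ ≤ (P.prod Q) {p | t * (1 - d) < a p.1 * y p.2} + P {ω | t * d < |b ω|} := by
        rw [hmarginal]
        gcongr
        exact measure_prod_setOf_lt_mul_mono ha ha0 hy measurable_abs hν _
    _ ≤ Q {ω | t < y ω} := hdrift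

theorem iterate_affineStep_setOf_lt_abs_le (ha : Measurable a) (ha0 : ∀ᵐ ω ∂P, 0 < a ω)
    (hab : HasLaw (fun ω => (a ω, b ω)) κ P) (hy : Measurable y) (ht₀ : 0 ≤ t₀)
    (hyt₀ : ∀ᵐ ω ∂Q, t₀ < y ω)
    (hdrift : ∀ t, t₀ ≤ t → (P.prod Q) {p | t * (1 - d) < a p.1 * y p.2} +
      P {ω | t * d < |b ω|} ≤ Q {ω | t < y ω}) (n : ℕ) (t : ℝ) :
    ((affineStep κ)^[n] (diracProba 0) : Measure ℝ) {x | t < |x|} ≤ Q {ω | t < y ω} := by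
  have hone {t : ℝ} (ht : t < t₀) : Q {ω | t < y ω} = 1 :=
    (prob_compl_eq_zero_iff (measurableSet_lt measurable_const hy)).1 <|
      measure_eq_zero_iff_ae_notMem.2 <| hyt₀.mono fun ω hω => by simpa using ht.trans hω
  induction n generalizing t with
  | zero =>
    rcases lt_or_ge t t₀ with ht | ht
    · exact prob_le_one.trans_eq (hone ht).symm
    · change Measure.dirac 0 {x | t < |x|} ≤ _
      simp [(ht₀.trans ht).not_gt]
  | succ n ih =>
    rcases lt_or_ge t t₀ with ht | ht
    · exact prob_le_one.trans_eq (hone ht).symm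
    · rw [Function.iterate_succ_apply']
      exact affineStep_setOf_lt_abs_le ha ha0 hab hy ih (hdrift t ht)

end AffineStep

theorem measure_setOf_lt_abs_le_of_tendsto {ι : Type*} {l : Filter ι} [l.NeBot]
    {μ : ι → ProbabilityMeasure ℝ} {ν : ProbabilityMeasure ℝ} (h : Tendsto μ l (𝓝 ν))
    {t : ℝ} {c : ℝ≥0∞} (hμ : ∀ i, (μ i : Measure ℝ) {x | t < |x|} ≤ c) :
    (ν : Measure ℝ) {x | t < |x|} ≤ c :=
  (ProbabilityMeasure.le_liminf_measure_open_of_tendsto h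
    (isOpen_lt continuous_const continuous_abs)).trans <|
    (liminf_le_liminf (.of_forall hμ)).trans (liminf_const c).le

namespace RegularlyVaryingTail

theorem isBigO_tail {Ω : Type*} [MeasurableSpace Ω] {P : Measure Ω} [IsProbabilityMeasure P]
    {a b : Ω → ℝ} {α : ℝ} {κ : ProbabilityMeasure (ℝ × ℝ)} {ν : ProbabilityMeasure ℝ}
    (h : RegularlyVaryingTail P a α) (ha : Measurable a)
    (ha0 : ∀ᵐ ω ∂P, 0 < a ω) (hint : Integrable (fun ω => a ω ^ α) P)
    (hm : ∫ ω, a ω ^ α ∂P < 1)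
    (hconv : AsympEq (fun t => (P.prod P).real {p : Ω × Ω | t < a p.1 * a p.2})
      (fun t => 2 * (∫ ω, a ω ^ α ∂P) * P.real {ω | t < a ω}))
    (hb : (fun t => P.real {ω | t < |b ω|}) =O[atTop] fun t => P.real {ω | t < a ω})
    (hab : HasLaw (fun ω => (a ω, b ω)) κ P)
    (hν : Tendsto (fun n => (affineStep κ)^[n] (diracProba 0)) atTop (𝓝 ν)) :
    (fun t => (ν : Measure ℝ).real {x | t < |x|}) =O[atTop] fun t => P.real {ω | t < a ω} := by
  obtain ⟨d, t₀, ht₀, hdrift⟩ := h.exists_cond_drift ha ha0 hint hm hconv hb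
  have hcond : IsProbabilityMeasure P[|{ω | t₀ < a ω}] :=
    cond_isProbabilityMeasure (s := {ω | t₀ < a ω}) (h.measure_ne_zero t₀)
  have hmem : ∀ᵐ ω ∂P[|{ω | t₀ < a ω}], t₀ < a ω :=
    ae_cond_mem (measurableSet_lt measurable_const ha)
  have hle (t : ℝ) : (ν : Measure ℝ) {x | t < |x|} ≤ P[|{ω | t₀ < a ω}] {ω | t < a ω} :=
    measure_setOf_lt_abs_le_of_tendsto hν fun n =>
      iterate_affineStep_setOf_lt_abs_le ha ha0 hab ha ht₀ hmem hdrift n t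
  refine IsBigO.of_bound (P.real {ω | t₀ < a ω})⁻¹ ?_
  filter_upwards [eventually_ge_atTop t₀] with t ht
  rw [Real.norm_of_nonneg measureReal_nonneg, Real.norm_of_nonneg measureReal_nonneg,
    ← measureReal_cond_setOf_lt ha ht]
  exact ENNReal.toReal_mono (measure_ne_top _ _) (hle t)

end RegularlyVaryingTail

theorem exists_lt_measure_ne_zero {ν : Measure ℝ} (h : ∀ c : ℝ, ¬ ∀ᵐ x ∂ν, x = c) :
    ∃ c₁ c₂ : ℝ, c₁ < c₂ ∧ ν (Set.Iio c₁) ≠ 0 ∧ ν (Set.Ioi c₂) ≠ 0 := by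
  have hsupport : ν.support.Nontrivial := by
    by_contra hsub
    rcases (Set.not_nontrivial_iff.1 hsub).eq_empty_or_singleton with hempty | ⟨c, hc⟩
    · exact h 0 (mem_of_superset Measure.support_mem_ae (by simp [hempty]))
    · exact h c (mem_of_superset Measure.support_mem_ae (by simp [hc]))
  obtain ⟨u, hu, v, hv, huv⟩ := hsupport.exists_lt
  obtain ⟨c₁, huc₁, hc₁v⟩ := exists_between huv
  obtain ⟨c₂, hc, hc₂v⟩ := exists_between hc₁v
  exact ⟨c₁, c₂, hc, ((Measure.mem_support_iff_forall _).1 hu _ (Iio_mem_nhds huc₁)).ne',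
    ((Measure.mem_support_iff_forall _).1 hv _ (Ioi_mem_nhds hc₂v)).ne'⟩

theorem exists_pos_measure_Ioi_ne_zero {ν : Measure ℝ} (h : ν (Set.Ioi 0) ≠ 0) :
    ∃ δ > 0, ν (Set.Ioi δ) ≠ 0 := by
  obtain ⟨x, hx, hx_support⟩ := Measure.nonempty_inter_support_of_pos (pos_iff_ne_zero.2 h)
  obtain ⟨δ, hδ, hδx⟩ := exists_between (Set.mem_Ioi.1 hx)
  exact ⟨δ, hδ, ((Measure.mem_support_iff_forall _).1 hx_support _ (Ioi_mem_nhds hδx)).ne'⟩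

section LowerBound

variable {Ω : Type*} [MeasurableSpace Ω] {P : Measure Ω} {a b : Ω → ℝ} {ν : Measure ℝ}
  [IsProbabilityMeasure ν]

theorem ae_affine_eq_of_ae_eq (hν : HasLaw (fun q : Ω × ℝ => a q.1 * q.2 + b q.1) ν (P.prod ν))
    {c : ℝ} (hc : ∀ᵐ x ∂ν, x = c) : ∀ᵐ ω ∂P, a ω * c + b ω = c := by
  have hprod : ∀ᵐ q ∂P.prod ν, a q.1 * q.2 + b q.1 = c :=
    (hν.ae_iff (p := fun x => x = c) (by fun_prop)).2 hc
  filter_upwards [Measure.ae_ae_of_ae_prod hprod] with ω hω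
  obtain ⟨x, hx, rfl⟩ := (hω.and hc).exists
  exact hx

theorem ae_affine_nonpos_of_measure_Ioi_ne_zero
    (hν : HasLaw (fun q : Ω × ℝ => a q.1 * q.2 + b q.1) ν (P.prod ν)) (ha0 : ∀ᵐ ω ∂P, 0 < a ω)
    (hnonpos : ∀ᵐ x ∂ν, x ≤ 0) {c : ℝ} (hc : ν (Set.Ioi c) ≠ 0) :
    ∀ᵐ ω ∂P, a ω * c + b ω ≤ 0 := by
  have hprod : ∀ᵐ q ∂P.prod ν, a q.1 * q.2 + b q.1 ≤ 0 :=
    (hν.ae_iff (p := fun x => x ≤ 0) (by fun_prop)).2 hnonpos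
  filter_upwards [ha0, Measure.ae_ae_of_ae_prod hprod] with ω hω hle
  obtain ⟨x, hcx, hx⟩ := ((frequently_ae_mem_iff.2 hc).and_eventually hle).exists
  have hmul : a ω * c ≤ a ω * x := mul_le_mul_of_nonneg_left (Set.mem_Ioi.1 hcx).le hω.le
  linarith

theorem isBigO_tail_of_eventually_forall_lt [IsFiniteMeasure P]
    (hν : HasLaw (fun q : Ω × ℝ => a q.1 * q.2 + b q.1) ν (P.prod ν)) {U : ℝ → Set Ω} {V : Set ℝ}
    (hV : ν V ≠ 0)
    (hUV : ∀ᶠ t in atTop, ∀ᵐ ω ∂P, ω ∈ U t → ∀ x ∈ V, t < |a ω * x + b ω|) :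
    (fun t => P.real (U t)) =O[atTop] fun t => ν.real {x | t < |x|} := by
  have hV_pos : 0 < ν.real V := ENNReal.toReal_pos hV (measure_ne_top _ _)
  refine IsBigO.of_bound (ν.real V)⁻¹ ?_
  filter_upwards [hUV] with t ht
  rw [Real.norm_of_nonneg measureReal_nonneg, Real.norm_of_nonneg measureReal_nonneg,
    ← div_eq_inv_mul, le_div_iff₀ hV_pos, ← measureReal_prod_prod,
    ← measureReal_setOf_lt_abs_of_hasLaw hν]
  refine ENNReal.toReal_mono (measure_ne_top _ _) (measure_mono_ae ?_)
  filter_upwards [Measure.quasiMeasurePreserving_fst.ae ht] with q hq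
  exact fun hmem => hq hmem.1 q.2 hmem.2

namespace RegularlyVaryingTail

variable [IsFiniteMeasure P] {α : ℝ}

theorem isBigO_tail_of_measure_Ioi_ne_zero (h : RegularlyVaryingTail P a α)
    (hν : HasLaw (fun q : Ω × ℝ => a q.1 * q.2 + b q.1) ν (P.prod ν)) (hpos : ν (Set.Ioi 0) ≠ 0)
    (hab : (fun t => P.real {ω | t < a ω ∧ b ω < -t}) =o[atTop] fun t => P.real {ω | t < a ω}) :
    (fun t => P.real {ω | t < a ω}) =O[atTop] fun t => ν.real {x | t < |x|} := by
  obtain ⟨δ, hδ, hV⟩ := exists_pos_measure_Ioi_ne_zero hpos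
  -- The choice of `M` makes `a x > 2 t` on `{a > t M} × {x > δ}`.
  set M := max 1 (2 / δ)
  have hM : 1 ≤ M := le_max_left _ _
  have hMδ : 2 ≤ M * δ := (div_le_iff₀ hδ).1 (le_max_right _ _)
  have hscale := h.isTheta_mul_const (one_pos.trans_le hM)
  have hdiff : (fun t => P.real {ω | t * M < a ω}) =O[atTop]
      fun t => P.real ({ω | t * M < a ω} \ {ω | t < a ω ∧ b ω < -t}) := by
    refine IsBigO.of_bound 2 ?_
    filter_upwards [(hab.trans_isBigO hscale.isBigO_symm).bound one_half_pos] with t ht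
    simp only [Real.norm_of_nonneg measureReal_nonneg] at ht ⊢
    linarith [le_measureReal_sdiff (μ := P) (s₁ := {ω | t * M < a ω})
      (s₂ := {ω | t < a ω ∧ b ω < -t})]
  refine hscale.isBigO_symm.trans (hdiff.trans (isBigO_tail_of_eventually_forall_lt hν hV ?_))
  filter_upwards [eventually_gt_atTop 0] with t ht
  refine .of_forall fun ω hω x hx => ?_
  have haM : t * M < a ω := hω.1
  have hat : t < a ω := (le_mul_of_one_le_right ht.le hM).trans_lt haM
  have hbt : -t ≤ b ω := not_lt.1 fun hlt => hω.2 ⟨hat, hlt⟩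
  have hax : t * M * δ < a ω * x := mul_lt_mul'' haM hx (by positivity) hδ.le
  have h2t : t * 2 ≤ t * M * δ := by
    rw [mul_assoc]
    exact mul_le_mul_of_nonneg_left hMδ ht.le
  exact lt_abs.2 (Or.inl (by linarith))

theorem isBigO_tail_of_ae_nonpos (h : RegularlyVaryingTail P a α) (ha0 : ∀ᵐ ω ∂P, 0 < a ω)
    (hν : HasLaw (fun q : Ω × ℝ => a q.1 * q.2 + b q.1) ν (P.prod ν))
    (hnonpos : ∀ᵐ x ∂ν, x ≤ 0) (hdeg : ∀ c : ℝ, ¬ ∀ᵐ x ∂ν, x = c) :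
    (fun t => P.real {ω | t < a ω}) =O[atTop] fun t => ν.real {x | t < |x|} := by
  obtain ⟨c₁, c₂, hc, hc₁, hc₂⟩ := exists_lt_measure_ne_zero hdeg
  have hc₂_affine := ae_affine_nonpos_of_measure_Ioi_ne_zero hν ha0 hnonpos hc₂
  have hgap : 0 < c₂ - c₁ := sub_pos.2 hc
  refine (h.isTheta_mul_const (inv_pos.2 hgap)).isBigO_symm.trans <|
    isBigO_tail_of_eventually_forall_lt hν hc₁ <| .of_forall fun t => ?_
  filter_upwards [ha0, hc₂_affine] with ω hω hle hlt x hx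
  have ht : t < a ω * (c₂ - c₁) := (mul_inv_lt_iff₀ hgap).1 hlt
  have hax : a ω * x ≤ a ω * c₁ := mul_le_mul_of_nonneg_left (Set.mem_Iio.1 hx).le hω.le
  exact lt_abs.2 (Or.inr (by linarith))

theorem isBigO_tail_of_not_ae_const (h : RegularlyVaryingTail P a α) (ha0 : ∀ᵐ ω ∂P, 0 < a ω)
    (hν : HasLaw (fun q : Ω × ℝ => a q.1 * q.2 + b q.1) ν (P.prod ν))
    (hab : (fun t => P.real {ω | t < a ω ∧ b ω < -t}) =o[atTop] fun t => P.real {ω | t < a ω})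
    (hdeg : ∀ c : ℝ, ¬ ∀ᵐ ω ∂P, a ω * c + b ω = c) :
    (fun t => P.real {ω | t < a ω}) =O[atTop] fun t => ν.real {x | t < |x|} := by
  by_cases hpos : ν (Set.Ioi 0) = 0
  · have hnonpos : ∀ᵐ x ∂ν, x ≤ 0 :=
      (measure_eq_zero_iff_ae_notMem.1 hpos).mono fun x hx => not_lt.1 hx
    exact h.isBigO_tail_of_ae_nonpos ha0 hν hnonpos fun c hc =>
      hdeg c (ae_affine_eq_of_ae_eq hν hc)
  · exact h.isBigO_tail_of_measure_Ioi_ne_zero hν hpos hab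

end RegularlyVaryingTail

end LowerBound

theorem mainTheorem3 {Ω : Type*} [MeasurableSpace Ω] (P : Measure Ω) [IsProbabilityMeasure P]
    -- the i.i.d. sequence of pairs `(A, B)`, with generic element `(A 0, B 0)`
    (A B : ℕ → Ω → ℝ) (hA : ∀ n, Measurable (A n)) (hB : ∀ n, Measurable (B n))
    (hindep : iIndepFun (fun n ω => (A n ω, B n ω)) P)
    (hident : ∀ n, IdentDistrib (fun ω => (A n ω, B n ω)) (fun ω => (A 0 ω, B 0 ω)) P P)
    -- the initial state, independent of the sequence
    (X₀ : Ω → ℝ) (hX₀ : Measurable X₀)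
    (hX₀_indep : IndepFun X₀ (fun ω n => (A n ω, B n ω)) P)
    (α : ℝ) (hα : 0 < α)
    (hA_pos : ∀ᵐ ω ∂P, 0 < A 0 ω)
    -- `A` has a regularly varying tail and a finite moment of order `α`
    (hA_tail : ∀ y : ℝ, 0 < y →
      AsympEq (fun t => P.real {ω | t * y < A 0 ω}) (fun t => y ^ (-α) * P.real {ω | t < A 0 ω}))
    (hA_int : Integrable (fun ω => A 0 ω ^ α) P)
    -- the tail of the product of `A` and an independent copy of `A`
    (hA_conv : AsympEq (fun t => (P.prod P).real {p : Ω × Ω | t < A 0 p.1 * A 0 p.2})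
      (fun t => 2 * (∫ ω, A 0 ω ^ α ∂P) * P.real {ω | t < A 0 ω}))
    (hA_moment : ∫ ω, A 0 ω ^ α ∂P < 1)
    (hB_tail : limsup (fun t : ℝ => P {ω | t < |B 0 ω|} / P {ω | t < A 0 ω}) atTop < ∞) :
    -- the series defining `X` converges absolutely, and the law of `X` is the unique stationary law
    (∀ᵐ ω ∂P, Summable (fun k => perpetuityTerm A B k ω)) ∧
    IsStationaryLaw (P.map (fun ω => (A 0 ω, B 0 ω))) (P.map (perpetuity A B)) ∧
    (∀ ν : Measure ℝ, IsProbabilityMeasure ν →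
      IsStationaryLaw (P.map (fun ω => (A 0 ω, B 0 ω))) ν → ν = P.map (perpetuity A B)) ∧
    -- weak convergence of the chain
    TendstoInDistribution (affineChain A B X₀) atTop (perpetuity A B) (fun _ => P) P ∧
    -- the upper bound
    ((fun t : ℝ => P.real {ω | t < |perpetuity A B ω|}) =O[atTop]
      (fun t : ℝ => P.real {ω | t < A 0 ω})) ∧
    -- the two-sided bound, for non-degenerate coefficients
    ((∀ c : ℝ, ¬ ∀ᵐ ω ∂P, A 0 ω * c + B 0 ω = c) →
      ((fun t : ℝ => P.real {ω | t < A 0 ω ∧ B 0 ω < -t}) =o[atTop]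
        (fun t : ℝ => P.real {ω | t < A 0 ω})) →
      WeaklyEquiv (fun t : ℝ => P {ω | t < |perpetuity A B ω|})
        (fun t : ℝ => P {ω | t < A 0 ω})) := by
  obtain ⟨κ, hκ⟩ := exists_probabilityMeasure_hasLaw ((hA 0).prodMk (hB 0)).aemeasurable (P := P)
  have hAB : IsIIDPairs A B κ P :=
    ⟨fun n => (hA n).prodMk (hB n), hindep, fun n => (hident n).symm.hasLaw hκ⟩
  have hRV : RegularlyVaryingTail P (A 0) α := hA_tail
  obtain ⟨δ, hδ, hδ1, hAδ, hBδ⟩ := exists_lintegral_rpow_lt_one_and_ne_top hα hA_pos hA_int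
    hA_moment hRV.measure_ne_zero hB_tail hκ
  have hS := hAB.ae_summable_perpetuityTerm hδ hδ1 hAδ hBδ
  have hprod := hAB.ae_tendsto_prod_range_zero hδ hδ1 hAδ
  obtain ⟨ν, hX⟩ := exists_probabilityMeasure_hasLaw (hAB.aemeasurable_perpetuity hS)
  have hlim := hAB.tendsto_iterate_affineStep hS hprod hX
  have hν := isStationaryLaw_of_tendsto_iterate_affineStep (hlim ν)
  have hB_isBigO := (limsup_div_lt_top_iff_isBigO_toReal (by finiteness) (by finiteness)).1 hB_tail
  have hupper :=
    hRV.isBigO_tail (hA 0) hA_pos hA_int hA_moment hA_conv hB_isBigO hκ (hlim (diracProba 0))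
  simp only [← measureReal_setOf_lt_abs_of_hasLaw hX] at hupper
  rw [hκ.map_eq, hX.map_eq]
  refine ⟨hS, hν, fun μ hμ hμ_stat => congrArg Subtype.val <|
      IsStationaryLaw.eq_of_tendsto_iterate_affineStep (μ := ⟨μ, hμ⟩) hμ_stat (hlim _),
    hAB.tendstoInDistribution_affineChain hS hprod hX₀.aemeasurable hX₀_indep, hupper,
    fun hdeg hAB_tail => ?_⟩
  have hlower := hRV.isBigO_tail_of_not_ae_const hA_pos (hν.hasLaw_affine_prod hκ) hAB_tail hdeg
  simp only [← measureReal_setOf_lt_abs_of_hasLaw hX] at hlower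
  exact (weaklyEquiv_iff_isTheta_toReal (by finiteness) (by finiteness) hRV.measure_ne_zero).2
    ⟨hupper, hlower⟩
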